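/- For integers $n\ge r\ge 1$ let $p_n^{(r)}=\sum_{\lambda} m_\lambda$ be the sum of the monomial symmetric functions over the partitions $\lambda$ of $n$ with exactly $r$ parts. Specialize the elementary symmetric functions to $e_k=q^{\binom k2}/k!$ for $k\ge 1$, so that $p_n^{(r)}$ becomes an element of $\mathbb{Q}(q)$, and define $J_n^{(r)}\in\mathbb{Q}(q)$ by $$p_n^{(r)}=(1-q)^{n-r}\,\frac{q^{\binom r2}}{r!\,(n-r)!}\,J_n^{(r)}(q).$$ For integers $a,b\ge 1$ and $m\ge 0$ let $\mathcal F_m(a,b)$ be the set of sequences $F=(S_1,\dots,S_a)$ of (possibly empty) rooted forests on pairwise disjoint vertex sets with union $\{1,\dots,m\}$, each of whose edges carries a color in $\{0,\dots,b-1\}$. Let $\operatorname{inv}(F)$ be the number of pairs of vertices $u>v$ such that $u$ lies on the path from $v$ to the root of its tree, let $d_F(v)$ be the sum of the colors of the edges on that path, and let $$I_m^{(a,b)}(q)=\sum_{F\in\mathcal F_m(a,b)} q^{\,\operatorname{inv}(F)+\sum_{i=1}^a (i-1)|S_i|+\sum_{v=1}^m d_F(v)}$$ be the Stanley–Yan inversion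 enumerator, where $|S_i|$ is the number of vertices of $S_i$. Then for all $n\ge r\ge 1$ $$J_n^{(r)}=I_{n-r}^{(r,1)};$$ equivalently, $I_m^{(r,1)}=J_{m+r}^{(r)}$ for all $m\ge 0$ and $r\ge 1$. In particular $J_n^{(r)}$ is a polynomial in $q$. -/

import Mathlib

open scoped Nat

noncomputable section

/-! ### The symmetric functions `p_n^{(r)}` and the polynomials `J_n^{(r)}` -/

/-- The symmetric function `p_n^{(r)} = ∑ m_λ`, the sum being over the partitions `λ` of `n` with
exactly `r` parts.  It is written in `n` variables, which is enough: the symmetric functions that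
are homogeneous of degree `n` are the same in `N` variables for all `N ≥ n` (and in infinitely many
variables). -/
def pSym (n r : ℕ) : MvPolynomial.symmetricSubalgebra (Fin n) ℚ :=
  ∑ μ : n.Partition with μ.parts.card = r,
    ⟨MvPolynomial.msymm (Fin n) ℚ μ, MvPolynomial.msymm_isSymmetric (Fin n) ℚ μ⟩

/-- The specialization `e_k ↦ e k` (`1 ≤ k ≤ N`) of the symmetric polynomials in `N` variables: the
unique `ℚ`-algebra homomorphism that sends the `k`-th elementary symmetric polynomial to `e k`. -/
def specialize (N : ℕ) (e : ℕ → RatFunc ℚ) :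
    MvPolynomial.symmetricSubalgebra (Fin N) ℚ →ₐ[ℚ] RatFunc ℚ :=
  (MvPolynomial.aeval fun i : Fin N => e ((i : ℕ) + 1)).comp
    (MvPolynomial.esymmAlgEquiv (Fin N) ℚ (Fintype.card_fin N)).symm.toAlgHom

/-- The coefficient `q^(k choose 2) / k!` of `t^k` in the `q`-deformation of the exponential series;
here `q` is `RatFunc.X`. -/
def qExpCoeff (k : ℕ) : RatFunc ℚ := RatFunc.X ^ k.choose 2 / (k ! : RatFunc ℚ)

/-- `p_n^{(r)}` at `e_k = q^(k choose 2) / k!`, an element of `ℚ(q)`. -/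
def pSpec (n r : ℕ) : RatFunc ℚ := specialize n qExpCoeff (pSym n r)

/-- `J_n^{(r)}` for `1 ≤ r ≤ n`, given by
`p_n^{(r)} = (1 - q)^(n-r) * q^(r choose 2) / (r! (n-r)!) * J_n^{(r)}`
for the specialized `p_n^{(r)}`.  A priori it is only an element of `ℚ(q)`. -/
def J (n r : ℕ) : RatFunc ℚ :=
  pSpec n r /
    ((1 - RatFunc.X) ^ (n - r) * (RatFunc.X ^ r.choose 2 / ((r ! : RatFunc ℚ) * ((n - r)! : RatFunc ℚ))))

/-! ### Inversion enumerators of colored rooted forests -/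

/-- A sequence `(S_1, …, S_a)` of rooted `b`-forests (possibly empty) on disjoint vertex sets with
union the set `Fin m` of labels.  A rooted `b`-forest is a rooted forest each of whose edges carries
one of `b` colors `0, …, b - 1`. -/
structure ForestSeq (a b m : ℕ) where
  /-- `comp v = i` (with `i = 0, …, a - 1`) means that the vertex `v` lies in `S_(i+1)`. -/
  comp : Fin m → Fin a
  /-- `parent v = none` if `v` is a root; `parent v = some (w, c)` if `w` is the parent of `v` and
  the edge that joins them has color `c`. -/
  parent : Fin m → Option (Fin m × Fin b)
  comp_parent : ∀ v w c, parent v = some (w, c) → comp v = comp w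
  acyclic : ∀ v, ¬ Relation.TransGen (fun x y => ∃ c, parent x = some (y, c)) v v

namespace ForestSeq

variable {a b m : ℕ}

instance : Finite (ForestSeq a b m) :=
  Finite.of_injective (fun F => (F.comp, F.parent)) (by
    rintro ⟨c, p, _, _⟩ ⟨c', p', _, _⟩ h
    obtain ⟨rfl, rfl⟩ := Prod.mk.inj h
    rfl)

instance : Fintype (ForestSeq a b m) := Fintype.ofFinite _

/-- `F.ProperAnc u v`: the vertex `u` is different from `v` and lies on the path that joins `v` to
the root of its tree. -/
def ProperAnc (F : ForestSeq a b m) (u v : Fin m) : Prop :=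
  Relation.TransGen (fun x y => ∃ c, F.parent x = some (y, c)) v u

open Classical in
/-- The number of inversions: pairs `(u, v)` with `u > v` and `u` a proper ancestor of `v`. -/
def inv (F : ForestSeq a b m) : ℕ :=
  (Finset.univ.filter fun p : Fin m × Fin m => p.2 < p.1 ∧ F.ProperAnc p.1 p.2).card

/-- The color of the edge from `v` to its parent, and `0` if `v` is a root. -/
def edgeColor (F : ForestSeq a b m) (v : Fin m) : ℕ :=
  match F.parent v with
  | none => 0
  | some (_, c) => c

open Classical in
/-- The sum of the colors of the edges on the path from `v` to the root of its tree. -/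
def colorDepth (F : ForestSeq a b m) (v : Fin m) : ℕ :=
  ∑ u : Fin m with u = v ∨ F.ProperAnc u v, F.edgeColor u

/-- The statistic `inv(F) + ∑_i (i - 1) |S_i| + ∑_v d(v)`, where `|S_i|` is the number of vertices
of `S_i` and `d(v)` is the sum of the colors on the path from `v` to its root. -/
def weight (F : ForestSeq a b m) : ℕ :=
  F.inv + ∑ v, (F.comp v : ℕ) + ∑ v, F.colorDepth v

end ForestSeq

/-- The inversion enumerator `I_m^{(a,b)}`. -/
def I (a b m : ℕ) : Polynomial ℚ :=
  ∑ F : ForestSeq a b m, Polynomial.X ^ F.weight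

end

/-!
Write `E(t) = ∑ q^(k choose 2) t^k / k!` for the specialized generating function of the elementary
symmetric functions. Both sides of the theorem are read off from the series
`G_r(t) = E(-q^r t) / E(-t)` (`qExpRatio`), through the numbers
`invNum r m = m! [t^m] G_r(t) / (1 - q)^m`.

*Symmetric functions.* Marking each variable that occurs by `s`, the generating function of the
`p_n^{(r)}` is `∏ (1 + s (x_i t + x_i² t² + ⋯)) = ∏ (1 + (s - 1) x_i t) / ∏ (1 - x_i t)`. Taking
the coefficient of `s^r t^n` after clearing the denominator gives
`∑_{a + b = n} (-1)^a e_a p_b^{(r)} = (-1)^(n - r) (n choose r) e_n` (`sum_esymm_mul_pSymVars`), an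
identity of symmetric polynomials in any number `N` of variables. For `n ≤ N` the specialization
turns it into a recursion that determines the specialized `p_n^{(r)}`. The series
`q^(r choose 2) / r! * t^r G_r(t)` satisfies it as well, because
`(r + k choose 2) = (r choose 2) + (k choose 2) + r k`. So `J n r = invNum r (n - r)`
(`J_eq_invNum`).

*A differential equation.* From `E'(t) = E(q t)` one gets
`G_r' = G_r (G_1 - q^r G_1(q^r t))` (`derivative_qExpRatio`), that is, with
`[n] = 1 + q + ⋯ + q^(n-1)`,
`invNum r (m + 1) = ∑_k (m choose k) [r (k + 1)] invNum 1 k invNum r (m - k)` (`invNum_succ`).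

*Forests.* The inversion enumerators satisfy the same recursion (`forestSeqSum_eq_sum`). Fix a vertex
`v₀`, and let `A`, of size `k + 1`, be the vertex set of the tree that contains it, `j ∈ A` its root
and `i < r` the index of its forest. Deleting `j` leaves a single forest on `A \ {j}`; the other
trees form a sequence of `r` forests on the complement of `A`. The root `j` takes part in
`#{a ∈ A | a < j}` inversions and the indices on `A` add up to `i (k + 1)`; summing over `j` and `i`
gives `[k + 1] (1 + q^(k+1) + ⋯ + q^((r-1)(k+1))) = [r (k + 1)]`. Here forests are considered on
arbitrary finite subsets of a linearly ordered type, and the recursion shows by induction that the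
enumerator depends on the size of the subset only, so no relabelling of vertices is needed.
-/

noncomputable section

/-! ### Monomial symmetric polynomials by number of parts -/

/-- The sum of the monomial symmetric polynomials in `N` variables over the partitions of `n` with
exactly `r` parts. -/
def pSymVars (N n r : ℕ) : MvPolynomial.symmetricSubalgebra (Fin N) ℚ :=
  ∑ μ : n.Partition with μ.parts.card = r,
    ⟨MvPolynomial.msymm (Fin N) ℚ μ, MvPolynomial.msymm_isSymmetric (Fin N) ℚ μ⟩

theorem pSymVars_eq_sum_sym (N n r : ℕ) :
    (pSymVars N n r : MvPolynomial (Fin N) ℚ) =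
      ∑ s : Sym (Fin N) n with (Nat.Partition.ofSym s).parts.card = r,
        (s.1.map MvPolynomial.X).prod := by
  have h : ∀ μ : n.Partition, MvPolynomial.msymm (Fin N) ℚ μ =
      ∑ s : Sym (Fin N) n with Nat.Partition.ofSym s = μ, (s.1.map MvPolynomial.X).prod := by
    intro μ
    rw [MvPolynomial.msymm]
    exact (Finset.sum_subtype _ (by simp) fun s : Sym (Fin N) n =>
      (s.1.map (MvPolynomial.X (R := ℚ))).prod).symm
  rw [pSymVars, AddSubmonoidClass.coe_finsetSum]
  simp only [h]
  rw [Finset.sum_filter]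
  simp only [Finset.sum_filter]
  have h2 : ∀ μ : n.Partition, (if μ.parts.card = r then
      ∑ s : Sym (Fin N) n, if Nat.Partition.ofSym s = μ then
        (s.1.map (MvPolynomial.X (R := ℚ))).prod else 0 else 0) =
      ∑ s : Sym (Fin N) n, if Nat.Partition.ofSym s = μ then
        (if (Nat.Partition.ofSym s).parts.card = r then
          (s.1.map (MvPolynomial.X (R := ℚ))).prod else 0) else 0 := by
    intro μ
    split_ifs with hμ
    · refine Finset.sum_congr rfl fun s _ => ?_
      split_ifs <;> simp_all
    · symm
      refine Finset.sum_eq_zero fun s _ => ?_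
      split_ifs <;> simp_all
  simp only [h2]
  rw [Finset.sum_comm]
  simp

/-- In terms of exponent vectors: the number of parts is the number of variables that occur. -/
theorem pSymVars_eq_sum_monomial (N n r : ℕ) :
    (pSymVars N n r : MvPolynomial (Fin N) ℚ) =
      ∑ l ∈ Finset.finsuppAntidiag (Finset.univ : Finset (Fin N)) n with l.support.card = r,
        MvPolynomial.monomial l 1 := by
  classical
  rw [pSymVars_eq_sum_sym]
  refine Finset.sum_bij' (fun s _ => Multiset.toFinsupp s.1)
    (fun l hl => ⟨Finsupp.toMultiset l, by
      simp only [Finset.mem_filter, Finset.mem_finsuppAntidiag] at hl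
      rw [Finsupp.card_toMultiset, Finsupp.sum_fintype _ _ (by simp)]
      exact hl.1.1⟩) ?_ ?_ ?_ ?_ ?_
  · intro s hs
    simp only [Finset.mem_filter, Finset.mem_univ, true_and, Nat.Partition.ofSym,
      Multiset.card_map] at hs
    simp only [Finset.mem_filter, Finset.mem_finsuppAntidiag, Multiset.toFinsupp_support,
      Finset.subset_univ, and_true]
    refine ⟨?_, hs⟩
    change ∑ i, Multiset.count i s.1 = n
    rw [Multiset.sum_count_eq_card (by simp)]
    exact s.2
  · intro l hl
    simp only [Finset.mem_filter, Finset.mem_finsuppAntidiag] at hl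
    refine Finset.mem_filter.2 ⟨Finset.mem_univ _, ?_⟩
    refine (Multiset.card_map _ _).trans (Eq.trans ?_ hl.2)
    exact congrArg Finset.card (Finsupp.toFinset_toMultiset l)
  · intro s hs
    exact Subtype.ext (by simp)
  · intro l hl
    simp
  · intro s hs
    conv_lhs => rw [← Multiset.toFinsupp_toMultiset s.1]
    rw [Finsupp.toMultiset_map, Finsupp.prod_toMultiset, MvPolynomial.monomial_eq]
    rw [Finsupp.prod_mapDomain_index (by simp) (by intros; rw [pow_add])]
    simp

section Generating
open PowerSeries

variable {R : Type*} [CommRing R]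

/-- `1 + s (x t + x² t² + ⋯)`. -/
def markedGeom (s x : R) : R⟦X⟧ := mk fun k => if k = 0 then 1 else s * x ^ k

theorem one_sub_mul_markedGeom (s x : R) :
    (1 - C x * X) * markedGeom s x = 1 + C ((s - 1) * x) * X := by
  ext k
  rw [sub_mul, one_mul, mul_assoc, map_sub, coeff_C_mul]
  rcases k with _ | _ | k
  · simp [markedGeom]
  · simp [coeff_succ_X_mul, markedGeom, coeff_one, sub_mul]
  · simp [coeff_succ_X_mul, markedGeom, coeff_one]
    ring

theorem coeff_prod_markedGeom {ι : Type*} [DecidableEq ι] (S : Finset ι) (s : R) (x : ι → R)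
    (n : ℕ) :
    coeff n (∏ i ∈ S, markedGeom s (x i)) =
      ∑ l ∈ S.finsuppAntidiag n, s ^ l.support.card * ∏ i ∈ S, x i ^ l i := by
  rw [coeff_prod]
  refine Finset.sum_congr rfl fun l hl => ?_
  rw [Finset.mem_finsuppAntidiag] at hl
  have h : s ^ l.support.card = ∏ i ∈ S, if l i = 0 then 1 else s := by
    rw [← Finset.prod_const, ← Finset.prod_subset hl.2
      (f := fun i => if l i = 0 then 1 else s) (by intro i _ hi; simp_all)]
    exact Finset.prod_congr rfl fun i hi => by simp_all
  rw [h, ← Finset.prod_mul_distrib]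
  refine Finset.prod_congr rfl fun i _ => ?_
  simp only [markedGeom, coeff_mk]
  split_ifs with h0 <;> simp [h0]

theorem coeff_prod_one_add {ι : Type*} (S : Finset ι) (a : R) (x : ι → R) (n : ℕ) :
    coeff n (∏ i ∈ S, (1 + C (a * x i) * X)) =
      a ^ n * ∑ T ∈ S.powersetCard n, ∏ i ∈ T, x i := by
  classical
  rw [Finset.prod_one_add, map_sum, Finset.mul_sum]
  have h : ∀ T : Finset ι, coeff n (∏ i ∈ T, C (a * x i) * X) =
      if T.card = n then a ^ n * ∏ i ∈ T, x i else 0 := by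
    intro T
    rw [Finset.prod_mul_distrib, Finset.prod_const, ← map_prod, coeff_C_mul, coeff_X_pow,
      Finset.prod_mul_distrib, Finset.prod_const]
    by_cases hT : T.card = n
    · simp [hT]
    · simp [hT, Ne.symm hT]
  simp only [h]
  rw [← Finset.sum_filter]
  refine Finset.sum_congr ?_ fun _ _ => rfl
  ext T
  simp [Finset.mem_powersetCard]

theorem prod_mul_prod_markedGeom {ι : Type*} (S : Finset ι) (s : R) (x : ι → R) :
    (∏ i ∈ S, (1 + C (-1 * x i) * X)) * ∏ i ∈ S, markedGeom s (x i) =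
      ∏ i ∈ S, (1 + C ((s - 1) * x i) * X) := by
  rw [← Finset.prod_mul_distrib]
  refine Finset.prod_congr rfl fun i _ => ?_
  rw [← one_sub_mul_markedGeom, neg_one_mul, map_neg, neg_mul, ← sub_eq_add_neg]

end Generating

open MvPolynomial in
/-- The coefficient of `s^r t^n` in
`∏ (1 - x_i t) * ∏ (1 + s (x_i t + x_i² t² + ⋯)) = ∏ (1 + (s - 1) x_i t)`. -/
theorem sum_esymm_mul_pSymVars (N n r : ℕ) :
    ∑ ab ∈ Finset.HasAntidiagonal.antidiagonal n, (-1) ^ ab.1 * esymm (Fin N) ℚ ab.1 *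
      (pSymVars N ab.2 r : MvPolynomial (Fin N) ℚ) =
    (-1) ^ (n - r) * (n.choose r : MvPolynomial (Fin N) ℚ) * esymm (Fin N) ℚ n := by
  classical
  let x : Fin N → Polynomial (MvPolynomial (Fin N) ℚ) := fun i => Polynomial.C (X i)
  -- the variable of `Polynomial (MvPolynomial (Fin N) ℚ)` is the marker `s`
  have h1 := prod_mul_prod_markedGeom Finset.univ Polynomial.X x
  have hE : ∀ k : ℕ, ∑ T ∈ (Finset.univ : Finset (Fin N)).powersetCard k, ∏ i ∈ T, x i =
      Polynomial.C (esymm (Fin N) ℚ k) := by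
    intro k
    simp [x, esymm, map_sum, map_prod]
  have h2 := congrArg (fun f => Polynomial.coeff (PowerSeries.coeff n f) r) h1
  simp only [PowerSeries.coeff_mul, coeff_prod_one_add, hE, coeff_prod_markedGeom] at h2
  have h3 : ∀ k, (∑ l ∈ (Finset.univ : Finset (Fin N)).finsuppAntidiag k,
      Polynomial.X ^ l.support.card * ∏ i, x i ^ l i).coeff r =
        (pSymVars N k r : MvPolynomial (Fin N) ℚ) := by
    intro k
    rw [pSymVars_eq_sum_monomial, Polynomial.finsetSum_coeff, Finset.sum_filter]
    refine Finset.sum_congr rfl fun l _ => ?_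
    have : ∏ i, x i ^ l i = Polynomial.C (monomial l 1) := by
      rw [monomial_eq, Finsupp.prod_fintype _ _ (by simp)]
      simp [x, map_prod]
    rw [this, Polynomial.coeff_mul_C, Polynomial.coeff_X_pow]
    by_cases h : l.support.card = r
    · simp [h]
    · simp [h, Ne.symm h]
  rw [Polynomial.finsetSum_coeff, Polynomial.coeff_mul_C] at h2
  have h4 : ((Polynomial.X - 1 : Polynomial (MvPolynomial (Fin N) ℚ)) ^ n).coeff r =
      (-1) ^ (n - r) * (n.choose r : MvPolynomial (Fin N) ℚ) := by
    rw [sub_eq_add_neg, ← Polynomial.C_1, ← Polynomial.C_neg, Polynomial.coeff_X_add_C_pow]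
  rw [h4] at h2
  rw [← h2]
  refine Finset.sum_congr rfl fun ab _ => ?_
  rw [← h3, ← Polynomial.coeff_C_mul]
  simp

theorem specialize_esymm (N : ℕ) (e : ℕ → RatFunc ℚ) (he : e 0 = 1) (k : ℕ) (hk : k ≤ N) :
    specialize N e ⟨MvPolynomial.esymm (Fin N) ℚ k, MvPolynomial.esymm_isSymmetric _ _ _⟩ = e k := by
  rcases k with _ | k
  · have : (⟨MvPolynomial.esymm (Fin N) ℚ 0, MvPolynomial.esymm_isSymmetric _ _ _⟩ :
      MvPolynomial.symmetricSubalgebra (Fin N) ℚ) = 1 := Subtype.ext (by simp)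
    rw [this, map_one, he]
  · have h := MvPolynomial.esymmAlgEquiv_symm_apply (σ := Fin N) (R := ℚ)
      (Fintype.card_fin N) ⟨k, hk⟩
    exact (congrArg (MvPolynomial.aeval fun i : Fin N => e ((i : ℕ) + 1)) h).trans (by simp)

theorem sum_specialize_pSymVars (N n r : ℕ) (hn : n ≤ N) (e : ℕ → RatFunc ℚ) (he : e 0 = 1) :
    ∑ ab ∈ Finset.HasAntidiagonal.antidiagonal n, (-1) ^ ab.1 * e ab.1 *
      specialize N e (pSymVars N ab.2 r) =
    (-1) ^ (n - r) * (n.choose r : RatFunc ℚ) * e n := by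
  let es : ℕ → MvPolynomial.symmetricSubalgebra (Fin N) ℚ := fun k =>
    ⟨MvPolynomial.esymm (Fin N) ℚ k, MvPolynomial.esymm_isSymmetric _ _ _⟩
  have h : ∑ ab ∈ Finset.HasAntidiagonal.antidiagonal n, (-1) ^ ab.1 * es ab.1 * pSymVars N ab.2 r =
      (-1) ^ (n - r) * (n.choose r : MvPolynomial.symmetricSubalgebra (Fin N) ℚ) * es n := by
    apply Subtype.ext
    have := sum_esymm_mul_pSymVars N n r
    push_cast
    exact this
  have h2 := congrArg (specialize N e) h
  simp only [map_sum, map_mul, map_pow, map_neg, map_one, map_natCast] at h2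
  rw [specialize_esymm N e he n hn] at h2
  rw [← h2]
  refine Finset.sum_congr rfl fun ab hab => ?_
  rw [specialize_esymm N e he]
  have := Finset.HasAntidiagonal.mem_antidiagonal.1 hab
  omega

/-! ### The series `E(-q^r t) / E(-t)` -/

section Series
open PowerSeries Finset.HasAntidiagonal

/-- `E(-t) = ∑ (-1)^k q^(k choose 2) t^k / k!`. -/
def qExpNeg : (RatFunc ℚ)⟦X⟧ := mk fun k => (-1) ^ k * qExpCoeff k

theorem qExpCoeff_zero : qExpCoeff 0 = 1 := by simp [qExpCoeff]

theorem constantCoeff_qExpNeg : constantCoeff qExpNeg = 1 := by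
  rw [← coeff_zero_eq_constantCoeff_apply]
  simp [qExpNeg, qExpCoeff_zero]

theorem qExpNeg_ne_zero : qExpNeg ≠ 0 := by
  intro h
  have := constantCoeff_qExpNeg
  simp [h] at this

/-- The equation `E'(t) = E(q t)`, for the argument `-t`. -/
theorem derivative_qExpNeg : d⁄dX (RatFunc ℚ) qExpNeg = -rescale RatFunc.X qExpNeg := by
  ext k
  have h1 : ((k + 1 : ℕ) : RatFunc ℚ) ≠ 0 := Nat.cast_ne_zero.2 k.succ_ne_zero
  have h2 : (k ! : RatFunc ℚ) ≠ 0 := Nat.cast_ne_zero.2 k.factorial_ne_zero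
  rw [coeff_derivative, map_neg, coeff_rescale, qExpNeg, coeff_mk, coeff_mk, qExpCoeff, qExpCoeff,
    Nat.factorial_succ, Nat.choose_succ_succ' k 1, Nat.choose_one_right]
  push_cast at h1 ⊢
  field_simp
  ring

theorem derivative_rescale (a : RatFunc ℚ) (f : (RatFunc ℚ)⟦X⟧) :
    d⁄dX (RatFunc ℚ) (rescale a f) = C a * rescale a (d⁄dX (RatFunc ℚ) f) := by
  ext k
  rw [coeff_derivative, coeff_C_mul, coeff_rescale, coeff_rescale, coeff_derivative]
  ring

/-- The series `E(-q^r t) / E(-t)`. -/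
def qExpRatio (r : ℕ) : (RatFunc ℚ)⟦X⟧ := rescale (RatFunc.X ^ r) qExpNeg * qExpNeg⁻¹

theorem qExpRatio_mul (r : ℕ) : qExpRatio r * qExpNeg = rescale (RatFunc.X ^ r) qExpNeg := by
  rw [qExpRatio, mul_assoc, PowerSeries.inv_mul_cancel, mul_one]
  rw [constantCoeff_qExpNeg]
  exact one_ne_zero

theorem derivative_qExpRatio (r : ℕ) :
    d⁄dX (RatFunc ℚ) (qExpRatio r) =
      (qExpRatio 1 - C (RatFunc.X ^ r) * rescale (RatFunc.X ^ r) (qExpRatio 1)) * qExpRatio r := by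
  apply mul_right_cancel₀ qExpNeg_ne_zero
  have h := congrArg (d⁄dX (RatFunc ℚ)) (qExpRatio_mul r)
  rw [Derivation.leibniz, derivative_rescale, derivative_qExpNeg, smul_eq_mul, smul_eq_mul,
    map_neg] at h
  have h1 := qExpRatio_mul 1
  have h2 := congrArg (rescale ((RatFunc.X : RatFunc ℚ) ^ r)) h1
  rw [pow_one] at h1 h2
  rw [map_mul] at h2
  rw [← h2, ← h1, ← qExpRatio_mul r] at h
  linear_combination h

/-- The number `m! [t^m] E(-q^r t) / E(-t)`, divided by `(1 - q)^m`. -/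
def invNum (r m : ℕ) : RatFunc ℚ :=
  (m ! : RatFunc ℚ) * coeff m (qExpRatio r) / (1 - RatFunc.X) ^ m

theorem one_sub_X_ne_zero : (1 - RatFunc.X : RatFunc ℚ) ≠ 0 := by
  intro h
  have h2 : (RatFunc.X : RatFunc ℚ) = 1 := (sub_eq_zero.1 h).symm
  rw [← RatFunc.algebraMap_X, ← map_one (algebraMap (Polynomial ℚ) (RatFunc ℚ))] at h2
  simpa using congrArg (Polynomial.eval 0) (RatFunc.algebraMap_injective ℚ h2)

theorem invNum_zero (r : ℕ) : invNum r 0 = 1 := by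
  have h := congrArg constantCoeff (qExpRatio_mul r)
  rw [map_mul, constantCoeff_qExpNeg, ← coeff_zero_eq_constantCoeff_apply (rescale _ _),
    coeff_rescale, coeff_zero_eq_constantCoeff_apply, constantCoeff_qExpNeg] at h
  simpa [invNum] using h

theorem invNum_succ (r m : ℕ) :
    invNum r (m + 1) = ∑ k ∈ Finset.range (m + 1), (m.choose k : RatFunc ℚ) *
      (∑ j ∈ Finset.range (r * (k + 1)), RatFunc.X ^ j) * invNum 1 k * invNum r (m - k) := by
  have h := congrArg (coeff m) (derivative_qExpRatio r)
  rw [coeff_derivative, coeff_mul, Finset.Nat.sum_antidiagonal_eq_sum_range_succ_mk] at h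
  have hq := one_sub_X_ne_zero
  rw [invNum, Nat.factorial_succ]
  push_cast
  rw [mul_comm ((m : RatFunc ℚ) + 1), mul_assoc, mul_comm ((m : RatFunc ℚ) + 1), h, Finset.mul_sum,
    Finset.sum_div]
  refine Finset.sum_congr rfl fun k hk => ?_
  have hkm : k ≤ m := Nat.lt_succ_iff.1 (Finset.mem_range.1 hk)
  have hgeom : (∑ j ∈ Finset.range (r * (k + 1)), (RatFunc.X : RatFunc ℚ) ^ j) =
      (1 - RatFunc.X ^ (r * (k + 1))) / (1 - RatFunc.X) := by
    rw [eq_div_iff hq, mul_comm, mul_neg_geom_sum]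
  have hfac : (m ! : RatFunc ℚ) = m.choose k * k ! * (m - k)! := by
    exact_mod_cast (Nat.choose_mul_factorial_mul_factorial hkm).symm
  have hpow : (1 - RatFunc.X : RatFunc ℚ) ^ (m + 1) =
      (1 - RatFunc.X) * (1 - RatFunc.X) ^ k * (1 - RatFunc.X) ^ (m - k) := by
    rw [mul_assoc, ← pow_add, ← pow_succ']
    congr 1
    omega
  rw [hgeom, invNum, invNum, hfac, hpow, map_sub, coeff_C_mul, coeff_rescale]
  field_simp
  ring

/-- The number `N` of variables does not matter as long as `n ≤ N`. -/
theorem specialize_pSymVars (N r n : ℕ) (hn : n ≤ N) :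
    specialize N qExpCoeff (pSymVars N n r) =
      RatFunc.X ^ r.choose 2 / (r ! : RatFunc ℚ) * coeff n (X ^ r * qExpRatio r) := by
  -- the right-hand side satisfies the recursion of `sum_specialize_pSymVars`
  have key : ∀ n : ℕ, ∑ ab ∈ antidiagonal n, (-1) ^ ab.1 * qExpCoeff ab.1 *
      (RatFunc.X ^ r.choose 2 / (r ! : RatFunc ℚ) * coeff ab.2 (X ^ r * qExpRatio r)) =
      (-1) ^ (n - r) * (n.choose r : RatFunc ℚ) * qExpCoeff n := by
    intro n
    have h : coeff n (qExpNeg * (C (RatFunc.X ^ r.choose 2 / (r ! : RatFunc ℚ)) *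
        (X ^ r * qExpRatio r))) = (-1) ^ (n - r) * (n.choose r : RatFunc ℚ) * qExpCoeff n := by
      rw [show qExpNeg * (C (RatFunc.X ^ r.choose 2 / (r ! : RatFunc ℚ)) *
        (X ^ r * qExpRatio r)) = C (RatFunc.X ^ r.choose 2 / (r ! : RatFunc ℚ)) *
        (X ^ r * (qExpRatio r * qExpNeg)) by ring, qExpRatio_mul, coeff_C_mul, coeff_X_pow_mul']
      split_ifs with hrn
      · obtain ⟨k, rfl⟩ := Nat.exists_eq_add_of_le hrn
        rw [Nat.add_sub_cancel_left, coeff_rescale, qExpNeg, coeff_mk, qExpCoeff, qExpCoeff]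
        have hfac : ((r + k)! : RatFunc ℚ) = (r + k).choose r * r ! * k ! := by
          have := Nat.choose_mul_factorial_mul_factorial (Nat.le_add_right r k)
          rw [Nat.add_sub_cancel_left] at this
          exact_mod_cast this.symm
        have h0 : ((r + k)! : RatFunc ℚ) ≠ 0 := Nat.cast_ne_zero.2 (Nat.factorial_ne_zero _)
        have hch : ((r + k).choose r : RatFunc ℚ) ≠ 0 :=
          Nat.cast_ne_zero.2 (Nat.choose_pos hrn).ne'
        have hr0 : (r ! : RatFunc ℚ) ≠ 0 := Nat.cast_ne_zero.2 (Nat.factorial_ne_zero _)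
        have hk0 : (k ! : RatFunc ℚ) ≠ 0 := Nat.cast_ne_zero.2 (Nat.factorial_ne_zero _)
        have hc : ∀ k : ℕ, (r + k).choose 2 = r.choose 2 + k.choose 2 + r * k := by
          intro k
          induction k with
          | zero => simp
          | succ k ih =>
            rw [← add_assoc, Nat.choose_succ_succ' (r + k) 1, Nat.choose_succ_succ' k 1]
            simp only [Nat.choose_one_right]
            linarith
        rw [hfac, hc k]
        field_simp
        ring
      · rw [Nat.choose_eq_zero_of_lt (not_le.1 hrn)]
        simp
    rw [coeff_mul] at h
    rw [← h]
    refine Finset.sum_congr rfl fun ab _ => ?_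
    rw [coeff_C_mul, qExpNeg, coeff_mk]
  induction n using Nat.strong_induction_on with
  | _ n ih =>
    have h1 := (sum_specialize_pSymVars N n r hn qExpCoeff qExpCoeff_zero).trans (key n).symm
    rw [Finset.Nat.sum_antidiagonal_eq_sum_range_succ_mk,
      Finset.Nat.sum_antidiagonal_eq_sum_range_succ_mk, Finset.sum_range_succ',
      Finset.sum_range_succ'] at h1
    have h2 : ∀ k ∈ Finset.range n, (-1) ^ (k + 1) * qExpCoeff (k + 1) *
        specialize N qExpCoeff (pSymVars N (n - (k + 1)) r) = (-1) ^ (k + 1) * qExpCoeff (k + 1) *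
        (RatFunc.X ^ r.choose 2 / (r ! : RatFunc ℚ) *
          coeff (n - (k + 1)) (X ^ r * qExpRatio r)) := by
      intro k hk
      have := Finset.mem_range.1 hk
      rw [ih (n - (k + 1)) (by omega) (by omega)]
    rw [Finset.sum_congr rfl h2] at h1
    simpa [qExpCoeff_zero] using add_left_cancel h1

theorem J_eq_invNum (n r : ℕ) (hrn : r ≤ n) : J n r = invNum r (n - r) := by
  have hX : (RatFunc.X : RatFunc ℚ) ≠ 0 := RatFunc.X_ne_zero
  have hr0 : (r ! : RatFunc ℚ) ≠ 0 := Nat.cast_ne_zero.2 (Nat.factorial_ne_zero _)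
  have hk0 : ((n - r)! : RatFunc ℚ) ≠ 0 := Nat.cast_ne_zero.2 (Nat.factorial_ne_zero _)
  have hq := one_sub_X_ne_zero
  have h : pSpec n r = RatFunc.X ^ r.choose 2 / (r ! : RatFunc ℚ) *
      coeff (n - r) (qExpRatio r) := by
    have := specialize_pSymVars n r n le_rfl
    rw [coeff_X_pow_mul', if_pos hrn] at this
    exact this
  rw [J, h, invNum]
  field_simp

end Series

/-! ### Rooted forests: deleting the root of a tree -/

section Forests
open Relation

variable {V : Type*}

/-- The map `p`, which sends each vertex to its parent if it has one, is a rooted forest on the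
vertex set `S`.  Vertices outside `S` have the value `none`, so that forests on different subsets
of `V` are functions on the same type. -/
structure IsForestOn (S : Finset V) (p : V → Option V) : Prop where
  mem_of_eq_some : ∀ v w, p v = some w → v ∈ S ∧ w ∈ S
  acyclic : ∀ v, ¬ TransGen (fun x y => p x = some y) v v

/-- `A` is the vertex set of a tree of the forest `p`, and `j` is its root. -/
structure IsTreeAt (A : Finset V) (j : V) (p : V → Option V) : Prop where
  root : p j = none
  mem_iff : ∀ v, v ∈ A ↔ ReflTransGen (fun x y => p x = some y) v j

/-- The pair `(c, p)` encodes a sequence of `r` rooted forests on the vertex set `S`: the parent map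
is `p`, and `c v` is the index of the forest that contains `v`, with the value `0` outside `S`. -/
structure IsForestSeqOn {r : ℕ} [NeZero r] (S : Finset V)
    (F : (V → Fin r) × (V → Option V)) : Prop where
  forest : IsForestOn S F.2
  comp_eq : ∀ v w, F.2 v = some w → F.1 v = F.1 w
  comp_off : ∀ v, v ∉ S → F.1 v = 0

namespace IsForestOn

variable {S : Finset V} {p : V → Option V}

theorem eq_none (h : IsForestOn S p) {v : V} (hv : v ∉ S) : p v = none := by
  rw [Option.eq_none_iff_forall_ne_some]
  exact fun w hw => hv (h.mem_of_eq_some v w hw).1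

theorem mem_of_transGen (h : IsForestOn S p) {v w : V}
    (hvw : TransGen (fun x y => p x = some y) v w) : v ∈ S ∧ w ∈ S := by
  induction hvw with
  | single h1 => exact h.mem_of_eq_some _ _ h1
  | tail _ h1 ih => exact ⟨ih.1, (h.mem_of_eq_some _ _ h1).2⟩

theorem wellFounded [Finite V] (h : IsForestOn S p) :
    WellFounded fun y x : V => p x = some y := by
  have : Std.Irrefl (fun y x : V => TransGen (fun x y => p x = some y) x y) := ⟨h.acyclic⟩
  have : IsTrans V (fun y x : V => TransGen (fun x y => p x = some y) x y) :=
    ⟨fun _ _ _ h1 h2 => h2.trans h1⟩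
  exact Subrelation.wf (r := fun y x : V => TransGen (fun x y => p x = some y) x y)
    (fun h => TransGen.single h)
    (Finite.wellFounded_of_trans_of_irrefl
      (fun y x : V => TransGen (fun x y => p x = some y) x y))

theorem exists_root [Finite V] (h : IsForestOn S p) (v : V) :
    ∃ j, p j = none ∧ ReflTransGen (fun x y => p x = some y) v j := by
  induction v using h.wellFounded.induction with
  | _ v ih =>
    rcases hv : p v with _ | w
    · exact ⟨v, hv, .refl⟩
    · obtain ⟨j, hj, hwj⟩ := ih w hv
      exact ⟨j, hj, hwj.head hv⟩

theorem existsUnique_tree [Fintype V] (h : IsForestOn S p) (v : V) :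
    ∃! Aj : Finset V × V, v ∈ Aj.1 ∧ IsTreeAt Aj.1 Aj.2 p := by
  classical
  obtain ⟨j, hj, hvj⟩ := h.exists_root v
  refine ⟨(Finset.univ.filter fun x => ReflTransGen (fun x y => p x = some y) x j, j),
    ⟨by simpa using hvj, hj, by simp⟩, ?_⟩
  rintro ⟨A, k⟩ ⟨hvA, hA⟩
  have hvk := (hA.mem_iff v).1 hvA
  have hU : Relator.RightUnique fun x y => p x = some y := by
    intro a b c hb hc
    exact Option.some.inj (hb.symm.trans hc)
  have heq : ∀ {a b : V}, p a = none → ReflTransGen (fun x y => p x = some y) a b → a = b := by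
    intro a b ha hab
    rcases hab.cases_head with h1 | ⟨c, hc, _⟩
    · exact h1
    · simp [ha] at hc
  have hkj : k = j := by
    rcases ReflTransGen.total_of_right_unique hU hvk hvj with h1 | h1
    · exact heq hA.root h1
    · exact (heq hj h1).symm
  subst hkj
  refine Prod.ext ?_ rfl
  ext x
  simp [hA.mem_iff]

end IsForestOn

namespace IsTreeAt

variable {A : Finset V} {j : V} {p : V → Option V}

theorem root_mem (h : IsTreeAt A j p) : j ∈ A := (h.mem_iff j).2 .refl

theorem mem_iff_of_eq_some (h : IsTreeAt A j p) {v w : V} (hvw : p v = some w) :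
    v ∈ A ↔ w ∈ A := by
  rw [h.mem_iff, h.mem_iff]
  refine ⟨fun hv => ?_, fun hw => hw.head hvw⟩
  rcases hv.cases_head with rfl | ⟨c, hc, hcj⟩
  · simp [h.root] at hvw
  · rw [hvw] at hc
    rwa [Option.some.inj hc]

theorem exists_parent (h : IsTreeAt A j p) {v : V} (hv : v ∈ A) (hvj : v ≠ j) :
    ∃ w, p v = some w := by
  rcases ((h.mem_iff v).1 hv).cases_head with h1 | ⟨c, hc, _⟩
  · exact absurd h1 hvj
  · exact ⟨c, hc⟩

theorem subset {S : Finset V} (h : IsTreeAt A j p) (hp : IsForestOn S p) {v : V} (hvS : v ∈ S)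
    (hvA : v ∈ A) : A ⊆ S := by
  have hj : j ∈ S := by
    rcases reflTransGen_iff_eq_or_transGen.1 ((h.mem_iff v).1 hvA) with rfl | h1
    · exact hvS
    · exact (hp.mem_of_transGen h1).2
  intro x hx
  by_cases hxj : x = j
  · rwa [hxj]
  · obtain ⟨w, hw⟩ := h.exists_parent hx hxj
    exact (hp.mem_of_eq_some _ _ hw).1

theorem comp_eq {r : ℕ} [NeZero r] {S : Finset V} {F : (V → Fin r) × (V → Option V)}
    (h : IsTreeAt A j F.2) (hF : IsForestSeqOn S F) {v : V} (hv : v ∈ A) : F.1 v = F.1 j := by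
  have hvj := (h.mem_iff v).1 hv
  induction hvj using ReflTransGen.head_induction_on with
  | refl => rfl
  | head h1 _ ih => exact (hF.comp_eq _ _ h1).trans (ih ((h.mem_iff_of_eq_some h1).1 hv))

end IsTreeAt

variable [DecidableEq V]

/-- The forest obtained by joining the roots of the forest `p₁` on `A \ {j}` to `j`, and by adding
the trees of the forest `p₂`. -/
def joinForest (A : Finset V) (j : V) (p₁ p₂ : V → Option V) (v : V) : Option V :=
  if v = j then none else if v ∈ A then some ((p₁ v).getD j) else p₂ v

/-- The forest that remains of the tree on `A` with root `j` when `j` is deleted. -/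
def innerForest (A : Finset V) (j : V) (p : V → Option V) (v : V) : Option V :=
  if v ∈ A ∧ p v ≠ some j then p v else none

/-- The forest that remains when the vertices in `A` are deleted. -/
def outerForest (A : Finset V) (p : V → Option V) (v : V) : Option V :=
  if v ∈ A then none else p v

section Join

variable {S A : Finset V} {j : V} {p p₁ p₂ : V → Option V}

theorem joinForest_of_mem {v : V} (hv : v ∈ A.erase j) :
    joinForest A j p₁ p₂ v = some ((p₁ v).getD j) := by
  rw [Finset.mem_erase] at hv
  rw [joinForest, if_neg hv.1, if_pos hv.2]

theorem joinForest_of_notMem (hj : j ∈ A) {v : V} (hv : v ∉ A) :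
    joinForest A j p₁ p₂ v = p₂ v := by
  rw [joinForest, if_neg (by rintro rfl; exact hv hj), if_neg hv]

theorem joinForest_root : joinForest A j p₁ p₂ j = none := if_pos rfl

theorem joinForest_eq_some (hj : j ∈ A) (h₁ : IsForestOn (A.erase j) p₁)
    (h₂ : IsForestOn (S \ A) p₂) {v w : V} :
    joinForest A j p₁ p₂ v = some w ↔
      p₁ v = some w ∨ (v ∈ A.erase j ∧ p₁ v = none ∧ w = j) ∨ p₂ v = some w := by
  by_cases hv : v ∈ A.erase j
  · have h2 : p₂ v = none := h₂.eq_none (by simp_all)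
    rw [joinForest_of_mem hv, h2]
    rcases hp : p₁ v with _ | u
    · simp [hv, eq_comm]
    · simp
  · have h1 : p₁ v = none := h₁.eq_none hv
    by_cases hvA : v ∈ A
    · have hvj : v = j := by simp_all
      have h2 : p₂ v = none := h₂.eq_none (by simp_all)
      rw [h1, h2, hvj, joinForest_root]
      simp
    · simp [joinForest_of_notMem hj hvA, h1, hv]

/-- The only new ancestor relations are that `j` becomes an ancestor of every vertex of `A \ {j}`. -/
theorem transGen_joinForest [Finite V] (hj : j ∈ A) (h₁ : IsForestOn (A.erase j) p₁)
    (h₂ : IsForestOn (S \ A) p₂) {x y : V} :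
    TransGen (fun x y => joinForest A j p₁ p₂ x = some y) x y ↔
      TransGen (fun x y => p₁ x = some y) x y ∨ (x ∈ A.erase j ∧ y = j) ∨
        TransGen (fun x y => p₂ x = some y) x y := by
  constructor
  · intro h
    induction h with
    | single h1 =>
      rcases (joinForest_eq_some hj h₁ h₂).1 h1 with h | h | h
      · exact .inl (.single h)
      · exact .inr (.inl ⟨h.1, h.2.2⟩)
      · exact .inr (.inr (.single h))
    | @tail b c _ h1 ih =>
      rcases ih with ih | ih | ih
      · have hx := (h₁.mem_of_transGen ih)
        rcases (joinForest_eq_some hj h₁ h₂).1 h1 with h | h | h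
        · exact .inl (ih.tail h)
        · exact .inr (.inl ⟨hx.1, h.2.2⟩)
        · have := (h₂.mem_of_eq_some _ _ h).1
          simp_all
      · rw [ih.2, joinForest_root] at h1
        simp at h1
      · have hb := (h₂.mem_of_transGen ih).2
        rw [joinForest_of_notMem hj (Finset.mem_sdiff.1 hb).2] at h1
        exact .inr (.inr (ih.tail h1))
  · rintro (h | ⟨hx, rfl⟩ | h)
    · exact TransGen.mono (fun _ _ h => (joinForest_eq_some hj h₁ h₂).2 (.inl h)) _ _ h
    · induction x using h₁.wellFounded.induction with
      | _ x ih =>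
        rcases hp : p₁ x with _ | w
        · exact .single ((joinForest_eq_some hj h₁ h₂).2 (.inr (.inl ⟨hx, hp, rfl⟩)))
        · exact (ih w hp (h₁.mem_of_eq_some _ _ hp).2).head
            ((joinForest_eq_some hj h₁ h₂).2 (.inl hp))
    · exact TransGen.mono (fun _ _ h => (joinForest_eq_some hj h₁ h₂).2 (.inr (.inr h))) _ _ h

theorem isForestOn_joinForest [Finite V] (hAS : A ⊆ S) (hj : j ∈ A)
    (h₁ : IsForestOn (A.erase j) p₁) (h₂ : IsForestOn (S \ A) p₂) :
    IsForestOn S (joinForest A j p₁ p₂) := by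
  refine ⟨fun v w h => ?_, fun v h => ?_⟩
  · rcases (joinForest_eq_some hj h₁ h₂).1 h with h | ⟨hv, _, rfl⟩ | h
    · have := h₁.mem_of_eq_some _ _ h
      exact ⟨hAS (Finset.mem_of_mem_erase this.1), hAS (Finset.mem_of_mem_erase this.2)⟩
    · exact ⟨hAS (Finset.mem_of_mem_erase hv), hAS hj⟩
    · have := h₂.mem_of_eq_some _ _ h
      exact ⟨Finset.sdiff_subset this.1, Finset.sdiff_subset this.2⟩
  · rcases (transGen_joinForest hj h₁ h₂).1 h with h | ⟨hv, rfl⟩ | h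
    · exact h₁.acyclic v h
    · simp at hv
    · exact h₂.acyclic v h

theorem isTreeAt_joinForest [Finite V] (hj : j ∈ A)
    (h₁ : IsForestOn (A.erase j) p₁) (h₂ : IsForestOn (S \ A) p₂) :
    IsTreeAt A j (joinForest A j p₁ p₂) := by
  refine ⟨joinForest_root, fun v => ?_⟩
  rw [reflTransGen_iff_eq_or_transGen, transGen_joinForest hj h₁ h₂]
  constructor
  · intro hv
    by_cases hvj : v = j
    · exact .inl hvj.symm
    · exact .inr (.inr (.inl ⟨Finset.mem_erase.2 ⟨hvj, hv⟩, rfl⟩))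
  · rintro (h | h | h | h)
    · rwa [← h]
    · exact Finset.mem_of_mem_erase (h₁.mem_of_transGen h).1
    · exact Finset.mem_of_mem_erase h.1
    · exact absurd hj (Finset.mem_sdiff.1 (h₂.mem_of_transGen h).2).2

theorem isForestOn_innerForest (hp : IsForestOn S p) (ht : IsTreeAt A j p) :
    IsForestOn (A.erase j) (innerForest A j p) := by
  have key : ∀ {v w}, innerForest A j p v = some w → v ∈ A ∧ p v = some w ∧ w ≠ j := by
    intro v w h
    rw [innerForest] at h
    split_ifs at h with h1
    exact ⟨h1.1, h, by rintro rfl; exact h1.2 h⟩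
  refine ⟨fun v w h => ?_, fun v h => hp.acyclic v (TransGen.mono (fun _ _ h => (key h).2.1) _ _ h)⟩
  obtain ⟨hv, hvw, hwj⟩ := key h
  refine ⟨Finset.mem_erase.2 ⟨?_, hv⟩, Finset.mem_erase.2 ⟨hwj, (ht.mem_iff_of_eq_some hvw).1 hv⟩⟩
  rintro rfl
  simp [ht.root] at hvw

theorem isForestOn_outerForest (hp : IsForestOn S p) (ht : IsTreeAt A j p) :
    IsForestOn (S \ A) (outerForest A p) := by
  have key : ∀ {v w}, outerForest A p v = some w → v ∉ A ∧ p v = some w := by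
    intro v w h
    rw [outerForest] at h
    split_ifs at h with h1
    exact ⟨h1, h⟩
  refine ⟨fun v w h => ?_, fun v h => hp.acyclic v (TransGen.mono (fun _ _ h => (key h).2) _ _ h)⟩
  obtain ⟨hv, hvw⟩ := key h
  have := hp.mem_of_eq_some _ _ hvw
  exact ⟨Finset.mem_sdiff.2 ⟨this.1, hv⟩,
    Finset.mem_sdiff.2 ⟨this.2, fun hw => hv ((ht.mem_iff_of_eq_some hvw).2 hw)⟩⟩

theorem joinForest_inner_outer (ht : IsTreeAt A j p) :
    joinForest A j (innerForest A j p) (outerForest A p) = p := by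
  funext v
  rw [joinForest]
  split_ifs with h1 h2
  · rw [h1, ht.root]
  · obtain ⟨w, hw⟩ := ht.exists_parent h2 h1
    by_cases hwj : w = j
    · simp [innerForest, hw, hwj]
    · simp [innerForest, hw, hwj, h2]
  · simp [outerForest, h2]

theorem innerForest_joinForest (h₁ : IsForestOn (A.erase j) p₁) :
    innerForest A j (joinForest A j p₁ p₂) = p₁ := by
  funext v
  by_cases hv : v ∈ A.erase j
  · have hvA := Finset.mem_of_mem_erase hv
    rw [innerForest, joinForest_of_mem hv]
    rcases hp : p₁ v with _ | w
    · simp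
    · have := (h₁.mem_of_eq_some _ _ hp).2
      simp_all
  · rw [h₁.eq_none hv, innerForest]
    by_cases hvA : v ∈ A
    · have : v = j := by simp_all
      simp [this, joinForest_root]
    · simp [hvA]

theorem outerForest_joinForest (hj : j ∈ A) (h₂ : IsForestOn (S \ A) p₂) :
    outerForest A (joinForest A j p₁ p₂) = p₂ := by
  funext v
  rw [outerForest]
  split_ifs with hv
  · exact (h₂.eq_none (by simp [hv])).symm
  · exact joinForest_of_notMem hj hv

end Join

end Forests

/-! ### Inversion enumerators -/

section Enumerators
open Relation Polynomial

theorem geom_sum_mul_geom_sum {R : Type*} [CommSemiring R] (x : R) (r n : ℕ) :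
    (∑ i : Fin r, x ^ ((i : ℕ) * n)) * ∑ t ∈ Finset.range n, x ^ t =
      ∑ t ∈ Finset.range (r * n), x ^ t := by
  rw [Fin.sum_univ_eq_sum_range fun i => x ^ (i * n)]
  induction r with
  | zero => simp
  | succ r ih =>
    rw [Finset.sum_range_succ, add_mul, ih, Nat.succ_mul, Finset.sum_range_add, Finset.mul_sum]
    simp only [pow_add]

/-- The elements of `A` have `0, 1, …, #A - 1` smaller elements in `A`. -/
theorem sum_pow_card_lt {V : Type*} [LinearOrder V] {R : Type*} [CommSemiring R] (x : R) (A : Finset V) :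
    ∑ j ∈ A, x ^ (A.filter fun a => a < j).card = ∑ t ∈ Finset.range A.card, x ^ t := by
  induction A using Finset.induction_on_max with
  | empty => simp
  | insert a A hlt ih =>
    have ha : a ∉ A := fun h => lt_irrefl _ (hlt a h)
    rw [Finset.sum_insert ha, Finset.card_insert_of_notMem ha, Finset.sum_range_succ, add_comm, ← ih]
    congr 1
    · refine Finset.sum_congr rfl fun j hj => ?_
      rw [Finset.filter_insert, if_neg (hlt j hj).not_gt]
    · rw [Finset.filter_insert, if_neg (lt_irrefl a), Finset.filter_true_of_mem hlt]

variable {V : Type*} [Fintype V] [LinearOrder V]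

open Classical in
/-- The number of pairs `(u, v)` with `u > v` such that `u` is a proper ancestor of `v`. -/
def inversions (p : V → Option V) : ℕ :=
  (Finset.univ.filter fun x : V × V => x.2 < x.1 ∧
    TransGen (fun x y => p x = some y) x.2 x.1).card

open Classical in
/-- The inversion enumerator of the rooted forests on `S`. -/
def forestSum (S : Finset V) : ℚ[X] :=
  ∑ p : V → Option V with IsForestOn S p, X ^ inversions p

/-- The number of inversions plus the sum over the vertices of the index of their forest. -/
def forestSeqWeight {r : ℕ} (F : (V → Fin r) × (V → Option V)) : ℕ :=
  inversions F.2 + ∑ v, (F.1 v : ℕ)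

open Classical in
/-- The inversion enumerator of the sequences of `r` rooted forests on `S`. -/
def forestSeqSum (r : ℕ) [NeZero r] (S : Finset V) : ℚ[X] :=
  ∑ F : (V → Fin r) × (V → Option V) with IsForestSeqOn S F, X ^ forestSeqWeight F

theorem forestSeqSum_one (S : Finset V) : forestSeqSum 1 S = forestSum S := by
  classical
  rw [forestSeqSum, forestSum]
  refine Finset.sum_bij' (fun F _ => F.2) (fun p _ => (fun _ => 0, p)) ?_ ?_ ?_ ?_ ?_
  · intro F hF
    simpa using (Finset.mem_filter.1 hF).2.forest
  · intro p hp
    refine Finset.mem_filter.2 ⟨Finset.mem_univ _, (Finset.mem_filter.1 hp).2, ?_, ?_⟩ <;> simp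
  · intro F _
    exact Prod.ext (Subsingleton.elim _ _) rfl
  · intro p _
    rfl
  · intro F _
    simp [forestSeqWeight]

theorem inversions_joinForest {S A : Finset V} {j : V} {p₁ p₂ : V → Option V} (hj : j ∈ A)
    (h₁ : IsForestOn (A.erase j) p₁) (h₂ : IsForestOn (S \ A) p₂) :
    inversions (joinForest A j p₁ p₂) =
      inversions p₁ + (A.filter fun a => a < j).card + inversions p₂ := by
  classical
  rw [inversions, inversions, inversions]
  have hmid : (A.filter fun a => a < j).card = (Finset.univ.filter fun x : V × V =>
      x.2 < x.1 ∧ (x.2 ∈ A.erase j ∧ x.1 = j)).card := by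
    refine Finset.card_bij (fun a _ => (j, a)) ?_ ?_ ?_
    · intro a ha
      simp only [Finset.mem_filter] at ha
      simp [ha.1, ha.2, ha.2.ne]
    · intro a _ b _ h
      exact (Prod.mk.inj h).2
    · rintro ⟨u, v⟩ h
      simp only [Finset.mem_filter, Finset.mem_univ, true_and, Finset.mem_erase] at h
      obtain ⟨h1, ⟨_, h2⟩, rfl⟩ := h
      exact ⟨v, Finset.mem_filter.2 ⟨h2, h1⟩, rfl⟩
  rw [hmid, ← Finset.card_union_of_disjoint, ← Finset.card_union_of_disjoint]
  · congr 1
    ext x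
    simp only [Finset.mem_filter, Finset.mem_univ, true_and, Finset.mem_union,
      transGen_joinForest hj h₁ h₂]
    tauto
  · rw [Finset.disjoint_left]
    intro x hx hx2
    simp only [Finset.mem_filter, Finset.mem_univ, true_and, Finset.mem_union] at hx hx2
    have h := (Finset.mem_sdiff.1 (h₂.mem_of_transGen hx2.2).1).2
    rcases hx with hx | hx
    · exact h (Finset.mem_of_mem_erase (h₁.mem_of_transGen hx.2).1)
    · exact h (Finset.mem_of_mem_erase hx.2.1)
  · rw [Finset.disjoint_left]
    intro x hx hx2
    simp only [Finset.mem_filter, Finset.mem_univ, true_and] at hx hx2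
    have h := (h₁.mem_of_transGen hx.2).2
    rw [hx2.2.2] at h
    simp at h

open Classical in
/-- The enumerator of the sequences in which a given set `A` carries a tree with a given root `j`
that belongs to the forest with a given index `i`. -/
theorem sum_isTreeAt {r : ℕ} [NeZero r] {S A : Finset V} {j : V} (hAS : A ⊆ S) (hj : j ∈ A)
    (i : Fin r) :
    ∑ F : (V → Fin r) × (V → Option V) with
        IsForestSeqOn S F ∧ IsTreeAt A j F.2 ∧ F.1 j = i, (X : ℚ[X]) ^ forestSeqWeight F =
      X ^ ((i : ℕ) * A.card) * X ^ (A.filter fun a => a < j).card *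
        (forestSum (A.erase j) * forestSeqSum r (S \ A)) := by
  rw [forestSum, forestSeqSum, Finset.sum_mul_sum, ← Finset.sum_product', Finset.mul_sum]
  refine Finset.sum_bij'
    (fun F _ => (innerForest A j F.2, (fun v => if v ∈ A then 0 else F.1 v, outerForest A F.2)))
    (fun G _ => (fun v => if v ∈ A then i else G.2.1 v, joinForest A j G.1 G.2.2)) ?_ ?_ ?_ ?_ ?_
  · intro F hF
    obtain ⟨hF, ht, hi⟩ := (Finset.mem_filter.1 hF).2
    refine Finset.mem_product.2 ⟨Finset.mem_filter.2 ⟨Finset.mem_univ _,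
      isForestOn_innerForest hF.forest ht⟩, Finset.mem_filter.2 ⟨Finset.mem_univ _,
      isForestOn_outerForest hF.forest ht, ?_, ?_⟩⟩
    · intro v w hvw
      dsimp only at hvw ⊢
      rw [outerForest] at hvw
      split_ifs at hvw with hv
      rw [if_neg hv, if_neg (fun hw => hv ((ht.mem_iff_of_eq_some hvw).2 hw))]
      exact hF.comp_eq v w hvw
    · intro v hv
      dsimp only
      split_ifs with hvA
      · rfl
      · exact hF.comp_off v fun hvS => hv (Finset.mem_sdiff.2 ⟨hvS, hvA⟩)
  · intro G hG
    obtain ⟨h1, h2⟩ := Finset.mem_product.1 hG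
    replace h1 := (Finset.mem_filter.1 h1).2
    replace h2 := (Finset.mem_filter.1 h2).2
    refine Finset.mem_filter.2 ⟨Finset.mem_univ _,
      ⟨isForestOn_joinForest hAS hj h1 h2.forest, ?_, ?_⟩, isTreeAt_joinForest hj h1 h2.forest,
        if_pos hj⟩
    · intro v w hvw
      have hA := (isTreeAt_joinForest hj h1 h2.forest).mem_iff_of_eq_some hvw
      dsimp only at hvw ⊢
      by_cases hv : v ∈ A
      · rw [if_pos hv, if_pos (hA.1 hv)]
      · rw [if_neg hv, if_neg (fun hw => hv (hA.2 hw))]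
        rw [joinForest_of_notMem hj hv] at hvw
        exact h2.comp_eq v w hvw
    · intro v hv
      dsimp only
      rw [if_neg (fun hvA => hv (hAS hvA))]
      exact h2.comp_off v fun h => hv (Finset.sdiff_subset h)
  · intro F hF
    obtain ⟨hF, ht, hi⟩ := (Finset.mem_filter.1 hF).2
    refine Prod.ext ?_ (joinForest_inner_outer ht)
    funext v
    dsimp only
    split_ifs with hv
    · rw [← hi, ht.comp_eq hF hv]
    · rfl
  · intro G hG
    obtain ⟨h1, h2⟩ := Finset.mem_product.1 hG
    replace h1 := (Finset.mem_filter.1 h1).2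
    replace h2 := (Finset.mem_filter.1 h2).2
    refine Prod.ext (innerForest_joinForest h1)
      (Prod.ext ?_ (outerForest_joinForest hj h2.forest))
    funext v
    dsimp only
    split_ifs with hv
    · exact (h2.comp_off v (by simp [hv])).symm
    · rfl
  · intro F hF
    obtain ⟨hF, ht, hi⟩ := (Finset.mem_filter.1 hF).2
    have hinv := inversions_joinForest hj (isForestOn_innerForest hF.forest ht)
      (isForestOn_outerForest hF.forest ht)
    rw [joinForest_inner_outer ht] at hinv
    have hcomp : ∑ v, (F.1 v : ℕ) =
        (i : ℕ) * A.card + ∑ v, ((if v ∈ A then 0 else F.1 v : Fin r) : ℕ) := by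
      have h : ∀ v, (F.1 v : ℕ) = (if v ∈ A then (i : ℕ) else 0) +
          ((if v ∈ A then 0 else F.1 v : Fin r) : ℕ) := by
        intro v
        split_ifs with hv
        · rw [ht.comp_eq hF hv, hi]
          simp
        · simp
      rw [Finset.sum_congr rfl fun v _ => h v, Finset.sum_add_distrib]
      simp [mul_comm]
    rw [forestSeqWeight, hinv, hcomp]
    simp only [forestSeqWeight, ← pow_add]
    congr 1
    ring

/-- Sorting the sequences of forests by the tree that contains the vertex `v₀`, its root, and the
index of the forest to which it belongs. -/
theorem forestSeqSum_eq_sum {r : ℕ} [NeZero r] {S : Finset V} {v₀ : V} (hv₀ : v₀ ∈ S) :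
    forestSeqSum r S = ∑ A ∈ S.powerset with v₀ ∈ A, ∑ j ∈ A, ∑ i : Fin r,
      X ^ ((i : ℕ) * A.card) * X ^ (A.filter fun a => a < j).card *
        (forestSum (A.erase j) * forestSeqSum r (S \ A)) := by
  classical
  have hex : ∀ F : (V → Fin r) × (V → Option V), ∃ Aj : Finset V × V, IsForestSeqOn S F →
      (v₀ ∈ Aj.1 ∧ IsTreeAt Aj.1 Aj.2 F.2) ∧
      ∀ B : Finset V × V, v₀ ∈ B.1 ∧ IsTreeAt B.1 B.2 F.2 → B = Aj := by
    intro F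
    by_cases hF : IsForestSeqOn S F
    · obtain ⟨Aj, h1, h2⟩ := hF.forest.existsUnique_tree v₀
      exact ⟨Aj, fun _ => ⟨h1, h2⟩⟩
    · exact ⟨(∅, v₀), fun h => absurd h hF⟩
  -- `g F` is the pair of the vertex set and the root of the tree that contains `v₀`
  choose g hg using hex
  let T : Finset ((_ : Finset V) × (_ : V) × Fin r) :=
    (S.powerset.filter fun A => v₀ ∈ A).sigma fun A => A.sigma fun _ => Finset.univ
  have hmaps : ∀ F ∈ Finset.univ.filter fun F : (V → Fin r) × (V → Option V) =>
      IsForestSeqOn S F, (⟨(g F).1, (g F).2, F.1 (g F).2⟩ :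
        (_ : Finset V) × (_ : V) × Fin r) ∈ T := by
    intro F hF
    replace hF := (Finset.mem_filter.1 hF).2
    obtain ⟨⟨h1, h2⟩, _⟩ := hg F hF
    simp only [T, Finset.mem_sigma, Finset.mem_filter, Finset.mem_powerset, Finset.mem_univ,
      and_true]
    exact ⟨⟨h2.subset hF.forest hv₀ h1, h1⟩, h2.root_mem⟩
  rw [forestSeqSum, ← Finset.sum_fiberwise_of_maps_to hmaps, Finset.sum_sigma]
  refine Finset.sum_congr rfl fun A hA => ?_
  rw [Finset.sum_sigma]
  refine Finset.sum_congr rfl fun j hj => Finset.sum_congr rfl fun i _ => ?_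
  obtain ⟨hAS, hvA⟩ := Finset.mem_filter.1 hA
  rw [← sum_isTreeAt (Finset.mem_powerset.1 hAS) hj i, Finset.filter_filter]
  refine Finset.sum_congr (Finset.filter_congr fun F _ => and_congr_right fun hF => ?_)
    fun _ _ => rfl
  obtain ⟨⟨h1, h2⟩, h3⟩ := hg F hF
  constructor
  · intro h
    cases h
    exact ⟨h2, rfl⟩
  · rintro ⟨ht, rfl⟩
    rw [← h3 (A, j) ⟨hvA, ht⟩]

theorem forestSeqSum_empty (r : ℕ) [NeZero r] : forestSeqSum r (∅ : Finset V) = 1 := by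
  classical
  have h : (Finset.univ.filter fun F : (V → Fin r) × (V → Option V) => IsForestSeqOn ∅ F) =
      {(fun _ => 0, fun _ => none)} := by
    ext F
    simp only [Finset.mem_filter, Finset.mem_univ, true_and, Finset.mem_singleton]
    constructor
    · intro hF
      exact Prod.ext (funext fun v => hF.comp_off v (by simp))
        (funext fun v => hF.forest.eq_none (by simp))
    · rintro rfl
      refine ⟨⟨by simp, fun v h => ?_⟩, by simp, by simp⟩
      obtain ⟨w, hw, _⟩ := TransGen.head'_iff.1 h
      simp at hw
  have hinv : inversions (fun _ : V => (none : Option V)) = 0 := by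
    rw [inversions, Finset.card_eq_zero, Finset.filter_eq_empty_iff]
    rintro x - ⟨-, h⟩
    obtain ⟨w, hw, _⟩ := TransGen.head'_iff.1 h
    simp at hw
  rw [forestSeqSum, h, Finset.sum_singleton, forestSeqWeight, hinv]
  simp

/-- The enumerator depends only on the size of `S`: both sides satisfy the same recursion. -/
theorem forestSeqSum_eq_invNum (r : ℕ) [NeZero r] (S : Finset V) :
    algebraMap ℚ[X] (RatFunc ℚ) (forestSeqSum r S) = invNum r S.card := by
  classical
  induction hm : S.card using Nat.strong_induction_on generalizing r S with
  | _ m ih =>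
  subst hm
  rcases S.eq_empty_or_nonempty with rfl | ⟨v₀, hv₀⟩
  · rw [forestSeqSum_empty, Finset.card_empty, invNum_zero, map_one]
  have hterm : ∀ A ∈ S.powerset.filter fun A => v₀ ∈ A,
      algebraMap ℚ[X] (RatFunc ℚ) (∑ j ∈ A, ∑ i : Fin r,
        X ^ ((i : ℕ) * A.card) * X ^ (A.filter fun a => a < j).card *
          (forestSum (A.erase j) * forestSeqSum r (S \ A))) =
      (∑ t ∈ Finset.range (r * A.card), RatFunc.X ^ t) * invNum 1 (A.card - 1) *
        invNum r (S.card - A.card) := by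
    intro A hA
    obtain ⟨hAS, hvA⟩ := Finset.mem_filter.1 hA
    rw [Finset.mem_powerset] at hAS
    have hApos : 0 < A.card := Finset.card_pos.2 ⟨v₀, hvA⟩
    have hAle : A.card ≤ S.card := Finset.card_le_card hAS
    have hsd : (S \ A).card = S.card - A.card := Finset.card_sdiff_of_subset hAS
    have hout := ih (S.card - A.card) (by omega) r (S \ A) hsd
    rw [← geom_sum_mul_geom_sum, ← sum_pow_card_lt, map_sum, Finset.mul_sum, Finset.sum_mul,
      Finset.sum_mul]
    refine Finset.sum_congr rfl fun j hj => ?_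
    have hin := ih (A.card - 1) (by omega) 1 (A.erase j) (Finset.card_erase_of_mem hj)
    rw [forestSeqSum_one] at hin
    rw [map_sum, Finset.sum_mul, Finset.sum_mul, Finset.sum_mul]
    refine Finset.sum_congr rfl fun i _ => ?_
    rw [map_mul, map_mul, map_mul, map_pow, map_pow, RatFunc.algebraMap_X, hin, hout]
    ring
  rw [forestSeqSum_eq_sum hv₀, map_sum, Finset.sum_congr rfl hterm]
  obtain ⟨m, hm⟩ : ∃ m, S.card = m + 1 :=
    Nat.exists_eq_succ_of_ne_zero (Finset.card_ne_zero_of_mem hv₀)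
  have herase : (S.erase v₀).card = m := by rw [Finset.card_erase_of_mem hv₀, hm]; rfl
  rw [hm, invNum_succ]
  -- the sets `A` that contain `v₀` are the sets `insert v₀ B` with `B ⊆ S.erase v₀`
  have hB : ∑ A ∈ S.powerset with v₀ ∈ A,
      (∑ t ∈ Finset.range (r * A.card), RatFunc.X ^ t) * invNum 1 (A.card - 1) *
        invNum r (m + 1 - A.card) =
      ∑ B ∈ (S.erase v₀).powerset, (∑ t ∈ Finset.range (r * (B.card + 1)), RatFunc.X ^ t) *
        invNum 1 B.card * invNum r (m - B.card) := by
    refine Finset.sum_bij' (fun A _ => A.erase v₀) (fun B _ => insert v₀ B) ?_ ?_ ?_ ?_ ?_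
    · intro A hA
      obtain ⟨hAS, hvA⟩ := Finset.mem_filter.1 hA
      exact Finset.mem_powerset.2 (Finset.erase_subset_erase _ (Finset.mem_powerset.1 hAS))
    · intro B hB
      refine Finset.mem_filter.2 ⟨Finset.mem_powerset.2 ?_, Finset.mem_insert_self _ _⟩
      exact Finset.insert_subset hv₀ ((Finset.mem_powerset.1 hB).trans (Finset.erase_subset _ _))
    · intro A hA
      exact Finset.insert_erase (Finset.mem_filter.1 hA).2
    · intro B hB
      exact Finset.erase_insert fun h => by simpa using Finset.mem_powerset.1 hB h
    · intro A hA
      have hvA := (Finset.mem_filter.1 hA).2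
      rw [Finset.card_erase_add_one hvA, Finset.card_erase_of_mem hvA]
      congr 2
      have := Finset.card_pos.2 ⟨v₀, hvA⟩
      omega
  rw [hB, Finset.sum_powerset_apply_card (fun k =>
    (∑ t ∈ Finset.range (r * (k + 1)), RatFunc.X ^ t) * invNum 1 k * invNum r (m - k)), herase]
  refine Finset.sum_congr rfl fun k _ => ?_
  rw [nsmul_eq_mul]
  ring

end Enumerators

open Classical in
/-- With a single color the colors carry no information and do not contribute to the weight. -/
theorem I_eq_forestSeqSum (r m : ℕ) [NeZero r] :
    I r 1 m = forestSeqSum r (Finset.univ : Finset (Fin m)) := by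
  have hrel : ∀ o : Option (Fin m × Fin 1), ∀ y,
      (∃ c, o = some (y, c)) ↔ o.map Prod.fst = some y := by
    rintro (_ | ⟨w, c⟩) y
    · simp
    · simp [Subsingleton.elim _ c]
  have hrel' : ∀ q : Option (Fin m), ∀ y,
      (∃ c, q.map (fun w => (w, (0 : Fin 1))) = some (y, c)) ↔ q = some y := by
    rintro (_ | w) y <;> simp
  rw [I, forestSeqSum]
  refine Finset.sum_bij' (fun F _ => (F.comp, fun v => (F.parent v).map Prod.fst))
    (fun G hG =>
      { comp := G.1
        parent := fun v => (G.2 v).map fun w => (w, 0)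
        comp_parent := fun v w c h =>
          (Finset.mem_filter.1 hG).2.comp_eq v w ((hrel' _ _).1 ⟨c, h⟩)
        acyclic := fun v => by
          simpa only [hrel'] using (Finset.mem_filter.1 hG).2.forest.acyclic v }) ?_ ?_ ?_ ?_ ?_
  · intro F _
    refine Finset.mem_filter.2 ⟨Finset.mem_univ _, ⟨by simp, fun v => ?_⟩, fun v w h => ?_, by simp⟩
    · simpa only [← hrel] using F.acyclic v
    · obtain ⟨c, hc⟩ := (hrel _ _).2 h
      exact F.comp_parent v w c hc
  · intro G _
    exact Finset.mem_univ _
  · rintro ⟨c, p, _, _⟩ _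
    congr 1
    funext v
    dsimp only
    rcases p v with _ | ⟨w, d⟩
    · rfl
    · simp [Subsingleton.elim d 0]
  · intro G _
    refine Prod.ext rfl (funext fun v => ?_)
    dsimp only
    rcases G.2 v <;> rfl
  · intro F _
    have hcol : ∀ v, F.colorDepth v = 0 := by
      intro v
      refine Finset.sum_eq_zero fun u _ => ?_
      rw [ForestSeq.edgeColor]
      split
      · rfl
      · simp
    have hinv : F.inv = inversions fun v => (F.parent v).map Prod.fst := by
      simp only [ForestSeq.inv, inversions, ForestSeq.ProperAnc, hrel]
    rw [ForestSeq.weight, forestSeqWeight, hinv]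
    simp [hcol]

end

theorem corollary6p5 :
    (∀ n r : ℕ, 1 ≤ r → r ≤ n →
      J n r = algebraMap (Polynomial ℚ) (RatFunc ℚ) (I r 1 (n - r))) ∧
    (∀ m r : ℕ, 1 ≤ r →
      algebraMap (Polynomial ℚ) (RatFunc ℚ) (I r 1 m) = J (m + r) r) := by
  have key : ∀ r m : ℕ, 1 ≤ r →
      algebraMap (Polynomial ℚ) (RatFunc ℚ) (I r 1 m) = invNum r m := by
    intro r m hr
    have : NeZero r := ⟨by omega⟩
    rw [I_eq_forestSeqSum, forestSeqSum_eq_invNum, Finset.card_univ, Fintype.card_fin]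
  refine ⟨fun n r hr hrn => ?_, fun m r hr => ?_⟩
  · rw [J_eq_invNum n r hrn, key r (n - r) hr]
  · rw [J_eq_invNum (m + r) r (Nat.le_add_left r m), Nat.add_sub_cancel, key r m hr]
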